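/- For a finite simple graph $G$, let $X_G=\sum_{\kappa}\prod_{v\in V(G)}x_{\kappa(v)}$ be its chromatic symmetric function, where $x_1,x_2,\dots$ are countably many commuting indeterminates and the sum is over all proper colorings $\kappa\colon V(G)\to\{1,2,\dots\}$ of $G$. For an integer partition $\lambda=(\lambda_1,\lambda_2,\dots)$ write $e_\lambda=e_{\lambda_1}e_{\lambda_2}\cdots$, where $e_n=\sum_{1\le i_1<\dots<i_n}x_{i_1}\cdots x_{i_n}$ is the $n$-th elementary symmetric function. The graph $G$ is called $e$-positive if the expansion of $X_G$ in the basis $\{e_\lambda\}$ of the algebra of symmetric functions has only nonnegative coefficients. For integers $m\ge 3$ and $l\ge 1$, let the tadpole $\mathrm{Tp}_{m,l}$ be the graph on $m+l$ vertices obtained from the cycle $C_m$ on $m$ vertices and a path with $l$ edges (that is, $l+1$ vertices) by identifying a vertex of the cycle with an end of the path. Then, for all integers $m\ge 3$ and $l\ge 1$, the tadpole $\mathrm{Tp}_{m,l}$ is $e$-positive. -/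

import Mathlib

noncomputable section

/-- The monomial `∏ v, x_{κ v}` of a map `κ : V → ℕ`, as an exponent vector. The countably many
indeterminates are indexed by `ℕ`. -/
def colorMonomial {V : Type*} [Fintype V] (κ : V → ℕ) : ℕ →₀ ℕ :=
  ∑ v, Finsupp.single (κ v) 1

/-- Only finitely many maps have a given monomial, so the counts in
`chromaticSymmetricFunction` are counts of finite sets. -/
theorem finite_setOf_colorMonomial_eq {V : Type*} [Fintype V] (d : ℕ →₀ ℕ) :
    {κ : V → ℕ | colorMonomial κ = d}.Finite := by
  refine (Set.Finite.pi' (t := fun _ : V => (d.support : Set ℕ))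
    (fun _ => d.support.finite_toSet)).subset ?_
  intro κ hκ v
  have hκ' : colorMonomial κ = d := hκ
  have h : (Finsupp.single (κ v) 1 : ℕ →₀ ℕ) (κ v) ≤ d (κ v) := by
    rw [← hκ', colorMonomial, Finsupp.finsetSum_apply]
    exact Finset.single_le_sum (f := fun w => (Finsupp.single (κ w) 1 : ℕ →₀ ℕ) (κ v))
      (fun _ _ => Nat.zero_le _) (Finset.mem_univ v)
  simp only [Finsupp.single_eq_same] at h
  simp only [Finset.mem_coe, Finsupp.mem_support_iff]
  omega

/-- The chromatic symmetric function `X_G = ∑_κ ∏_v x_{κ(v)}`, the sum being over all proper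
colorings `κ` of `G` by the colors `0, 1, 2, …`: the coefficient of a monomial is the number of
proper colorings that contribute this monomial. -/
def chromaticSymmetricFunction {V : Type*} [Fintype V] (G : SimpleGraph V) : MvPowerSeries ℕ ℚ :=
  fun d => (Nat.card {κ : G.Coloring ℕ // colorMonomial (fun v => κ v) = d} : ℚ)

open scoped Classical in
/-- The elementary symmetric function `e_n = ∑_{i₁ < ⋯ < iₙ} x_{i₁} ⋯ x_{iₙ}`: the sum of all
squarefree monomials of degree `n`. -/
def elemSymm (n : ℕ) : MvPowerSeries ℕ ℚ :=
  fun d => if d.degree = n ∧ ∀ i, d i ≤ 1 then 1 else 0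

/-- `e_λ = e_{λ₁} e_{λ₂} ⋯` for an integer partition `λ`. -/
def elemSymmPartition {n : ℕ} (p : n.Partition) : MvPowerSeries ℕ ℚ :=
  (p.parts.map elemSymm).prod

/-- A symmetric function is `e`-positive if its expansion in the basis `e_λ`, with `λ` running over
the integer partitions of all natural numbers, has only nonnegative coefficients. -/
def IsEPositive (f : MvPowerSeries ℕ ℚ) : Prop :=
  ∃ c : (Σ n : ℕ, n.Partition) →₀ ℚ,
    (∀ p, 0 ≤ c p) ∧ f = c.sum fun p a => a • elemSymmPartition p.2

/-- A finite graph is `e`-positive if its chromatic symmetric function is. -/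
def SimpleGraph.IsEPositive {V : Type*} [Fintype V] (G : SimpleGraph V) : Prop :=
  _root_.IsEPositive (chromaticSymmetricFunction G)

/-- The tadpole graph with `m + l` vertices: a cycle on `m` vertices with a path attached at one
of its vertices `inl 0`. The path starts at `inl 0` and goes on through the `l` further vertices
`inr 0, …, inr (l - 1)`. -/
def tadpole (m l : ℕ) : SimpleGraph (Fin m ⊕ Fin l) :=
  (SimpleGraph.cycleGraph m ⊕g SimpleGraph.pathGraph l) ⊔
    SimpleGraph.fromRel fun a b =>
      ∃ (i : Fin m) (j : Fin l), i.val = 0 ∧ j.val = 0 ∧ a = Sum.inl i ∧ b = Sum.inr j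

end

/-! Write `P_n` and `T(m, l)` for the generating functions of paths and tadpoles. Expanding one edge
of the tail and one edge of the cycle at the junction gives terms that cancel (`tadpoleSum_succ`),
leaving `T(m, l+1) = T(m+1, l) + P_{l+1} T(m, 0) - P_{m+l+1}`. This reduces tadpoles to cycles `T(m,
0)` and paths, but with a negative term.

With `E = ∑ e_k z^k` and `D = 1 / (E - z E')`, one has `∑ P_n z^n = E D`, and the cycles have
generating function `z² E'' D` up to a constant. Since `E - z E' = 1 - ∑_{k ≥ 1} (k-1) e_k z^k`, the
coefficients `d_n` of `D` are sums over compositions of `n`, a block `k` weighing `(k-1) e_k`.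
Likewise `P_n` is a sum over compositions whose first block weighs `k e_k` and whose later blocks
weigh `(k-1) e_k`.

To absorb the negative term, `P_n` is split according to the block that covers position `l+1`
(`pathSum_crossing`). Each piece then matches a positive term already present and lowers its integer
coefficient by exactly one, never below zero. Induction on the tail length gives `tadpoleFormula`, a
polynomial in `e`, `d` and `P` with natural number coefficients (`tadpole_eq_formula`), so
`e`-positivity follows from closure under sums and products.

The transfer operator needs finitely many colors, so the identity is proved in `N` variables for
every `N` and lifted by `eq_of_restrictVars_eq`. -/

/-! ### Generating functions of words: paths, cycles and tadpoles. -/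

/-- The transfer operator of proper words: `g` is sent to `i ↦ ∑_{j ≠ i} x_j g(j)`. -/
def properTransfer {R σ : Type*} [CommRing R] [Fintype σ] (x : σ → R) :
    (σ → R) →ₗ[R] (σ → R) where
  toFun g i := ∑ j, x j * g j - x i * g i
  map_add' f g := by
    ext i
    simp only [Pi.add_apply, mul_add, Finset.sum_add_distrib]
    ring
  map_smul' c g := by
    ext i
    simp only [Pi.smul_apply, smul_eq_mul, RingHom.id_apply, mul_sub, Finset.mul_sum]
    congr 1
    · exact Finset.sum_congr rfl fun j _ => by ring
    · ring

/-- Generating function of the words of length `l` that stay proper when preceded by `i`. -/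
def tailSum {R σ : Type*} [CommRing R] [Fintype σ] (x : σ → R) (l : ℕ) : σ → R :=
  (properTransfer x ^ l) 1

/-- Generating function of the proper words of length `n`. -/
def pathSum {R σ : Type*} [CommRing R] [Fintype σ] (x : σ → R) : ℕ → R
  | 0 => 1
  | n + 1 => ∑ i, x i * tailSum x n i

/-- Generating function of the cyclically proper words of length `m` that begin with `i`. -/
def closedSum {R σ : Type*} [CommRing R] [Fintype σ] [DecidableEq σ] (x : σ → R) (m : ℕ)
    (i : σ) : R :=
  (properTransfer x ^ m) (Pi.single i 1) i

/-- Generating function of the proper colorings of a cycle of length `m` with a tail of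
length `l`. -/
def tadpoleSum {R σ : Type*} [CommRing R] [Fintype σ] [DecidableEq σ] (x : σ → R)
    (m l : ℕ) : R :=
  ∑ i, tailSum x l i * closedSum x m i

section WordSums

variable {R σ : Type*} [CommRing R] [Fintype σ] (x : σ → R)

theorem properTransfer_apply (g : σ → R) (i : σ) :
    properTransfer x g i = ∑ j, x j * g j - x i * g i := rfl

theorem tailSum_zero (i : σ) : tailSum x 0 i = 1 := by simp [tailSum]

theorem tailSum_succ (l : ℕ) (i : σ) :
    tailSum x (l + 1) i = pathSum x (l + 1) - x i * tailSum x l i := by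
  rw [tailSum, pow_succ', Module.End.mul_apply, properTransfer_apply]
  rfl

/-- Two tails glued at a common first letter form a single path. A letter can be moved from one tail
to the other: by `tailSum_succ`, lengthening either tail gives `P_{l+1} P_{m+1}` minus the same
symmetric sum. -/
theorem sum_mul_tailSum_mul_tailSum (l m : ℕ) :
    ∑ i, x i * tailSum x l i * tailSum x m i = pathSum x (m + l + 1) := by
  induction l generalizing m with
  | zero => simp [tailSum_zero, pathSum]
  | succ l ih =>
    rw [show m + (l + 1) + 1 = (m + 1) + l + 1 by ring, ← ih]
    simp only [tailSum_succ, mul_sub, sub_mul, Finset.sum_sub_distrib]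
    congr 1
    · calc ∑ i, x i * pathSum x (l + 1) * tailSum x m i
          = pathSum x (l + 1) * ∑ i, x i * tailSum x m i := by
            rw [Finset.mul_sum]; exact Finset.sum_congr rfl fun i _ => by ring
        _ = (∑ i, x i * tailSum x l i) * pathSum x (m + 1) := rfl
        _ = _ := by rw [Finset.sum_mul]
    · exact Finset.sum_congr rfl fun i _ => by ring

variable [DecidableEq σ]

theorem closedSum_zero (i : σ) : closedSum x 0 i = 1 := by simp [closedSum]

theorem properTransfer_single (i : σ) :
    properTransfer x (Pi.single i 1) = x i • (1 - Pi.single i 1 : σ → R) := by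
  ext j
  rw [properTransfer_apply]
  by_cases h : j = i
  · subst h
    simp [Pi.single_apply]
  · simp [Pi.single_apply, h]

/-- Deletion and contraction of the closing edge: the return to `i` costs `x i`, and words already
ending in `i` are removed. -/
theorem closedSum_succ (m : ℕ) (i : σ) :
    closedSum x (m + 1) i = x i * tailSum x m i - x i * closedSum x m i := by
  rw [closedSum, pow_succ, Module.End.mul_apply, properTransfer_single, map_smul, map_sub]
  simp [tailSum, closedSum, mul_sub]

/-- Both `tailSum_succ` and `closedSum_succ` produce the contracted term `x_i * tailSum x l i *
closedSum x m i`; eliminating it leaves only tadpoles and paths. -/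
theorem tadpoleSum_succ (m l : ℕ) :
    tadpoleSum x m (l + 1) =
      tadpoleSum x (m + 1) l + pathSum x (l + 1) * tadpoleSum x m 0 - pathSum x (m + l + 1) := by
  rw [← sum_mul_tailSum_mul_tailSum]
  simp only [tadpoleSum, Finset.mul_sum]
  rw [← Finset.sum_add_distrib, ← Finset.sum_sub_distrib]
  refine Finset.sum_congr rfl fun i _ => ?_
  rw [tailSum_succ, closedSum_succ, tailSum_zero]
  ring

end WordSums

/-! ### Power series for paths and cycles in terms of `E`. -/

section GeneratingFunctions

open PowerSeries

variable {R σ : Type*} [CommRing R] [Fintype σ] (x : σ → R)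

/-- The inverse of `1 + a z`. -/
noncomputable def geomInv (a : R) : R⟦X⟧ := PowerSeries.mk fun n => (-a) ^ n

theorem geomInv_mul (a : R) : (1 + C a * X) * geomInv a = 1 := by
  ext n
  rw [add_mul, one_mul, mul_assoc, map_add, coeff_C_mul]
  cases n with
  | zero => simp [geomInv]
  | succ n =>
    rw [coeff_succ_X_mul]
    simp [geomInv, coeff_one, pow_succ]
    ring

theorem derivative_geomInv (a : R) : d⁄dX R (geomInv a) = -(C a * geomInv a ^ 2) := by
  have h := congrArg (d⁄dX R) (geomInv_mul a)
  rw [Derivation.leibniz, map_add, Derivation.leibniz] at h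
  simp only [smul_eq_mul, derivative_X, derivative_C, Derivation.map_one_eq_zero] at h
  have h1 := geomInv_mul a
  linear_combination geomInv a * h - (d⁄dX R (geomInv a)) * h1

/-- `∏ i, (1 + x_i z)`. -/
noncomputable def elemSeries (x : σ → R) : R⟦X⟧ := ∏ i, (1 + C (x i) * X)

/-- The logarithmic derivative of `elemSeries`. -/
noncomputable def logDerivSeries (x : σ → R) : R⟦X⟧ := ∑ i, C (x i) * geomInv (x i)

theorem derivative_elemSeries :
    d⁄dX R (elemSeries x) = elemSeries x * logDerivSeries x := by
  classical
  have h : ∀ s : Finset σ, d⁄dX R (∏ i ∈ s, (1 + C (x i) * X)) =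
      (∏ i ∈ s, (1 + C (x i) * X)) * ∑ i ∈ s, C (x i) * geomInv (x i) := by
    intro s
    induction s using Finset.induction_on with
    | empty => simp
    | insert a s ha ih =>
      rw [Finset.prod_insert ha, Finset.sum_insert ha, Derivation.leibniz, ih, map_add,
        Derivation.leibniz]
      simp only [smul_eq_mul, derivative_X, derivative_C, Derivation.map_one_eq_zero]
      linear_combination (-(∏ i ∈ s, (1 + C (x i) * X)) * C (x a)) * geomInv_mul (x a)
  exact h Finset.univ

theorem derivative_logDerivSeries :
    d⁄dX R (logDerivSeries x) = -∑ i, C (x i) ^ 2 * geomInv (x i) ^ 2 := by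
  rw [logDerivSeries, map_sum, ← Finset.sum_neg_distrib]
  refine Finset.sum_congr rfl fun i _ => ?_
  rw [Derivation.leibniz, derivative_geomInv]
  simp only [smul_eq_mul, derivative_C]
  ring

theorem mk_tailSum (i : σ) :
    PowerSeries.mk (fun l => tailSum x l i) = geomInv (x i) * PowerSeries.mk (pathSum x) := by
  have h : (1 + C (x i) * X) * PowerSeries.mk (fun l => tailSum x l i) =
      PowerSeries.mk (pathSum x) := by
    ext n
    rw [add_mul, one_mul, mul_assoc, map_add, coeff_C_mul]
    cases n with
    | zero => simp [tailSum_zero, pathSum]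
    | succ n => rw [coeff_succ_X_mul]; simp [tailSum_succ]
  rw [← h, ← mul_assoc, mul_comm (geomInv _), geomInv_mul, one_mul]

theorem mk_pathSum :
    PowerSeries.mk (pathSum x) = 1 + X * logDerivSeries x * PowerSeries.mk (pathSum x) := by
  have h : PowerSeries.mk (pathSum x) =
      1 + ∑ i, C (x i) * X * PowerSeries.mk (fun l => tailSum x l i) := by
    ext n
    rw [map_add, map_sum]
    cases n with
    | zero => simp [pathSum]
    | succ n => simp [mul_assoc, coeff_succ_X_mul, pathSum, coeff_one]
  conv_lhs => rw [h]
  rw [logDerivSeries, Finset.mul_sum, Finset.sum_mul]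
  congr 1
  refine Finset.sum_congr rfl fun i _ => ?_
  rw [mk_tailSum]
  ring

theorem mk_pathSum_mul :
    PowerSeries.mk (pathSum x) * (elemSeries x - X * d⁄dX R (elemSeries x)) = elemSeries x := by
  rw [derivative_elemSeries]
  linear_combination elemSeries x * mk_pathSum x

variable [DecidableEq σ]

theorem mk_closedSum (i : σ) :
    PowerSeries.mk (fun m => closedSum x m i) =
      geomInv (x i) + X * C (x i) * geomInv (x i) ^ 2 * PowerSeries.mk (pathSum x) := by
  have h : (1 + C (x i) * X) * PowerSeries.mk (fun m => closedSum x m i) =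
      1 + C (x i) * (X * PowerSeries.mk (fun l => tailSum x l i)) := by
    ext n
    rw [add_mul, one_mul, mul_assoc, map_add, map_add, coeff_C_mul, coeff_C_mul]
    cases n with
    | zero => simp [closedSum_zero]
    | succ n => rw [coeff_succ_X_mul, coeff_succ_X_mul]; simp [closedSum_succ, coeff_one]
  rw [mk_tailSum] at h
  linear_combination geomInv (x i) * h -
    PowerSeries.mk (fun m => closedSum x m i) * geomInv_mul (x i)

theorem mk_tadpoleSum_zero :
    PowerSeries.mk (fun m => tadpoleSum x m 0) =
      (Fintype.card σ : R⟦X⟧) - X * logDerivSeries x +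
        X * PowerSeries.mk (pathSum x) * (logDerivSeries x + X * d⁄dX R (logDerivSeries x)) := by
  have h : PowerSeries.mk (fun m => tadpoleSum x m 0) =
      ∑ i, PowerSeries.mk (fun m => closedSum x m i) := by
    ext n
    simp [tadpoleSum, tailSum_zero]
  have hc : (Fintype.card σ : R⟦X⟧) = ∑ _i : σ, 1 := by simp
  rw [h, derivative_logDerivSeries, hc, logDerivSeries, ← Finset.sum_neg_distrib]
  simp only [Finset.mul_sum, ← Finset.sum_add_distrib, ← Finset.sum_sub_distrib]
  refine Finset.sum_congr rfl fun i _ => ?_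
  rw [mk_closedSum]
  -- With `g = 1 / (1 + x_i z)`, the identity `1 - x_i z g = g` turns the `i`-th summand of the
  -- right side into `g + z x_i g² P`.
  linear_combination (geomInv_mul (x i)) *
    (1 + X * C (x i) * geomInv (x i) * PowerSeries.mk (pathSum x))

/-- For `L = E'/E` one has `E'' = E (L² + L')`, and `P - 1 = z L P` turns `z L P - z L` into the
missing `z² L² P`. -/
theorem mk_tadpoleSum_zero_eq {D : R⟦X⟧}
    (hD : D * (elemSeries x - X * d⁄dX R (elemSeries x)) = 1) :
    PowerSeries.mk (fun m => tadpoleSum x m 0) =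
      (Fintype.card σ : R⟦X⟧) + X ^ 2 * d⁄dX R (d⁄dX R (elemSeries x)) * D := by
  have hP : PowerSeries.mk (pathSum x) = elemSeries x * D := by
    linear_combination D * mk_pathSum_mul x - PowerSeries.mk (pathSum x) * hD
  have h1 := mk_pathSum x
  rw [mk_tadpoleSum_zero]
  have h2 : d⁄dX R (d⁄dX R (elemSeries x)) = elemSeries x * logDerivSeries x ^ 2 +
      elemSeries x * d⁄dX R (logDerivSeries x) := by
    rw [derivative_elemSeries, Derivation.leibniz, derivative_elemSeries]
    simp only [smul_eq_mul]
    ring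
  rw [h2]
  rw [hP] at h1 ⊢
  linear_combination (X * logDerivSeries x) * h1

end GeneratingFunctions

/-! ### The positive expansion, from the recurrences alone. -/

/-- The convolution `∑ k, w(k) e(k) d(n - k)`. -/
def weightedConv {R : Type*} [CommRing R] (w e d : ℕ → R) (n : ℕ) : R :=
  ∑ k ∈ Finset.range (n + 1), w k * e k * d (n - k)

/-- The expansion of the tadpole on `n` vertices with tail of length `l` that shows its
`e`-positivity. Subtraction of natural numbers is truncated. -/
def tadpoleFormula {R : Type*} [CommRing R] (e d P : ℕ → R) (n l : ℕ) : R :=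
  weightedConv (fun k => ((k * (k - (l + 1)) : ℕ) : R)) e d n +
    ∑ s ∈ Finset.range l, P (s + 1) *
      weightedConv (fun k => (((s + k - l) * (k - 1) : ℕ) : R)) e d (n - (s + 1))

section Formula

variable {R : Type*} [CommRing R] {e d P : ℕ → R}

theorem weightedConv_sub (v w : ℕ → R) (n : ℕ) :
    weightedConv (fun k => v k - w k) e d n = weightedConv v e d n - weightedConv w e d n := by
  simp only [weightedConv, sub_mul, Finset.sum_sub_distrib]

theorem weightedConv_single {a n : ℕ} (h : a ≤ n) (c : R) :
    weightedConv (fun k => if k = a then c else 0) e d n = c * e a * d (n - a) := by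
  rw [weightedConv, Finset.sum_eq_single a]
  · simp
  · intro b _ hb
    simp [hb]
  · intro ha
    simp at ha
    omega

theorem map_weightedConv {S : Type*} [CommRing S] (φ : R →+* S) (w e d : ℕ → R) (n : ℕ) :
    φ (weightedConv w e d n) =
      weightedConv (fun k => φ (w k)) (fun k => φ (e k)) (fun k => φ (d k)) n := by
  simp [weightedConv, map_sum, map_mul]

theorem map_tadpoleFormula {S : Type*} [CommRing S] (φ : R →+* S) (e d P : ℕ → R) (n l : ℕ) :
    φ (tadpoleFormula e d P n l) =
      tadpoleFormula (fun k => φ (e k)) (fun k => φ (d k)) (fun k => φ (P k)) n l := by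
  simp only [tadpoleFormula, map_add, map_sum, map_mul, map_weightedConv, map_natCast]

/-- In the composition model of `P n`, this sorts by the block of size `k` covering position `l +
1`: either it is the first block, or blocks of total size `s + 1` precede it. The hypotheses `hP`
and `hPe` split off the first and the last block respectively. In the induction step, blocks ending
exactly at `l + 1` no longer cross; by `hPe` they add up to `P (l + 1) * d (n - (l + 1))`, which
`hd` expands by the next block. -/
theorem pathSum_crossing
    (hd : ∀ n, d (n + 1) = weightedConv (fun k => ((k - 1 : ℕ) : R)) e d (n + 1))
    (hP : ∀ n, P (n + 1) = weightedConv (fun k => (k : R)) e d (n + 1))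
    (hPe : ∀ l, P (l + 1) = ((l + 1 : ℕ) : R) * e (l + 1) +
      ∑ s ∈ Finset.range l, P (s + 1) * (((l - s - 1 : ℕ) : R) * e (l - s)))
    (l n : ℕ) (hln : l < n) :
    P n = weightedConv (fun k => if l < k then (k : R) else 0) e d n +
      ∑ s ∈ Finset.range l, P (s + 1) *
        weightedConv (fun k => if l < s + 1 + k then ((k - 1 : ℕ) : R) else 0) e d
          (n - (s + 1)) := by
  induction l with
  | zero =>
    obtain ⟨n, rfl⟩ := Nat.exists_eq_succ_of_ne_zero hln.ne'
    rw [Nat.succ_eq_add_one, hP, Finset.range_zero, Finset.sum_empty, add_zero]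
    congr 1
    ext k
    rcases Nat.eq_zero_or_pos k with rfl | hk
    · simp
    · simp [hk]
  | succ l ih =>
    have h1 : weightedConv (fun k => if l + 1 < k then (k : R) else 0) e d n =
        weightedConv (fun k => if l < k then (k : R) else 0) e d n -
          ((l + 1 : ℕ) : R) * e (l + 1) * d (n - (l + 1)) := by
      rw [← weightedConv_single (by omega), ← weightedConv_sub]
      congr 1
      ext k
      rcases lt_trichotomy k (l + 1) with h | rfl | h
      · rw [if_neg (by omega), if_neg (by omega), if_neg (by omega), sub_zero]
      · simp
      · rw [if_pos h, if_pos (by omega), if_neg (by omega), sub_zero]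
    have h2 : ∀ s ∈ Finset.range l, P (s + 1) *
        weightedConv (fun k => if l + 1 < s + 1 + k then ((k - 1 : ℕ) : R) else 0) e d
          (n - (s + 1)) = P (s + 1) *
        weightedConv (fun k => if l < s + 1 + k then ((k - 1 : ℕ) : R) else 0) e d
          (n - (s + 1)) - P (s + 1) * (((l - s - 1 : ℕ) : R) * e (l - s)) * d (n - (l + 1)) := by
      intro s hs
      rw [Finset.mem_range] at hs
      rw [show n - (l + 1) = n - (s + 1) - (l - s) by omega, mul_assoc (P (s + 1)), ← mul_sub,
        ← weightedConv_single (by omega), ← weightedConv_sub]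
      congr 2
      ext k
      rcases lt_trichotomy k (l - s) with h | rfl | h
      · rw [if_neg (by omega), if_neg (by omega), if_neg (by omega), sub_zero]
      · rw [if_neg (by omega), if_pos (by omega), if_pos rfl, sub_self]
      · rw [if_pos (by omega), if_pos (by omega), if_neg (by omega), sub_zero]
    have h3 : weightedConv (fun k => if l + 1 < l + 1 + k then ((k - 1 : ℕ) : R) else 0) e d
        (n - (l + 1)) = d (n - (l + 1)) := by
      obtain ⟨j, hj⟩ := Nat.exists_eq_succ_of_ne_zero (show n - (l + 1) ≠ 0 by omega)
      rw [hj, Nat.succ_eq_add_one, hd]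
      congr 1
      ext k
      rcases Nat.eq_zero_or_pos k with rfl | hk
      · simp
      · simp [hk]
    rw [Finset.sum_range_succ, Finset.sum_congr rfl h2, Finset.sum_sub_distrib, h1, h3,
      ← Finset.sum_mul]
    linear_combination ih (by omega) - d (n - (l + 1)) * hPe l

/-- Passing from `l` to `l + 1` lowers each nonzero truncated factor `k - (l + 1)` or `s + k - l` by
one, and these are nonzero exactly for the crossing blocks at position `l + 2`. So the subtracted
path is absorbed term by term. -/
theorem tadpole_eq_formula {T : ℕ → ℕ → R}
    (hd : ∀ n, d (n + 1) = weightedConv (fun k => ((k - 1 : ℕ) : R)) e d (n + 1))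
    (hP : ∀ n, P (n + 1) = weightedConv (fun k => (k : R)) e d (n + 1))
    (hPe : ∀ l, P (l + 1) = ((l + 1 : ℕ) : R) * e (l + 1) +
      ∑ s ∈ Finset.range l, P (s + 1) * (((l - s - 1 : ℕ) : R) * e (l - s)))
    (hC : ∀ m, T (m + 1) 0 = weightedConv (fun k => ((k * (k - 1) : ℕ) : R)) e d (m + 1))
    (hT : ∀ m l, T m (l + 1) = T (m + 1) l + P (l + 1) * T m 0 - P (m + l + 1))
    (m l : ℕ) : T (m + 1) l = tadpoleFormula e d P (m + 1 + l) l := by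
  induction l generalizing m with
  | zero => simp [hC, tadpoleFormula]
  | succ l ih =>
    rw [hT, ih, show m + 1 + 1 + l = m + 1 + (l + 1) by ring]
    have hx := pathSum_crossing hd hP hPe (l + 1) (m + 1 + (l + 1)) (by omega)
    rw [Finset.sum_range_succ] at hx
    rw [show m + 1 + l + 1 = m + 1 + (l + 1) by ring, hx, hC, tadpoleFormula, tadpoleFormula,
      Finset.sum_range_succ]
    have h1 : weightedConv (fun k => ((k * (k - (l + 1 + 1)) : ℕ) : R)) e d (m + 1 + (l + 1)) =
        weightedConv (fun k => ((k * (k - (l + 1)) : ℕ) : R)) e d (m + 1 + (l + 1)) -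
        weightedConv (fun k => if l + 1 < k then (k : R) else 0) e d (m + 1 + (l + 1)) := by
      rw [← weightedConv_sub]
      congr 1
      ext k
      split_ifs with h
      · obtain ⟨j, rfl⟩ := Nat.exists_eq_add_of_lt h
        rw [show l + 1 + j + 1 - (l + 1) = j + 1 by omega,
          show l + 1 + j + 1 - (l + 1 + 1) = j by omega]
        push_cast
        ring
      · simp [show k - (l + 1) = 0 by omega, show k - (l + 1 + 1) = 0 by omega]
    have h2 : ∀ s ∈ Finset.range l, P (s + 1) *
        weightedConv (fun k => (((s + k - (l + 1)) * (k - 1) : ℕ) : R)) e d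
          (m + 1 + (l + 1) - (s + 1)) = P (s + 1) *
        weightedConv (fun k => (((s + k - l) * (k - 1) : ℕ) : R)) e d
          (m + 1 + (l + 1) - (s + 1)) - P (s + 1) *
        weightedConv (fun k => if l + 1 < s + 1 + k then ((k - 1 : ℕ) : R) else 0) e d
          (m + 1 + (l + 1) - (s + 1)) := by
      intro s hs
      rw [← mul_sub, ← weightedConv_sub]
      congr 2
      ext k
      split_ifs with h
      · rw [show s + k - l = s + k - (l + 1) + 1 by omega]
        push_cast
        ring
      · simp [show s + k - l = 0 by omega, show s + k - (l + 1) = 0 by omega]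
    -- The new summand `s = l` comes from `P (l + 1)` times the cycle: `k (k - 1)` minus the
    -- crossing weight `k - 1` is `(k - 1)²`, with value zero at `k = 0` by truncation.
    have h3 : weightedConv (fun k => (((l + k - (l + 1)) * (k - 1) : ℕ) : R)) e d
          (m + 1 + (l + 1) - (l + 1)) =
        weightedConv (fun k => ((k * (k - 1) : ℕ) : R)) e d (m + 1) -
        weightedConv (fun k => if l + 1 < l + 1 + k then ((k - 1 : ℕ) : R) else 0) e d
          (m + 1 + (l + 1) - (l + 1)) := by
      rw [Nat.add_sub_cancel, ← weightedConv_sub]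
      congr 1
      ext k
      rcases Nat.eq_zero_or_pos k with rfl | hk
      · simp
      · obtain ⟨j, rfl⟩ := Nat.exists_eq_succ_of_ne_zero hk.ne'
        rw [show l + j.succ - (l + 1) = j by omega]
        simp
        ring
    rw [Finset.sum_congr rfl h2, Finset.sum_sub_distrib, h1, h3]
    ring

end Formula

/-! ### Closure properties of `e`-positivity. -/

section EPositive

theorem IsEPositive.zero : IsEPositive 0 := ⟨0, fun _ => le_rfl, by simp⟩

theorem IsEPositive.add {f g : MvPowerSeries ℕ ℚ} (hf : IsEPositive f) (hg : IsEPositive g) :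
    IsEPositive (f + g) := by
  obtain ⟨c, hc, rfl⟩ := hf
  obtain ⟨c', hc', rfl⟩ := hg
  refine ⟨c + c', fun p => add_nonneg (hc p) (hc' p), ?_⟩
  rw [Finsupp.sum_add_index'] <;> intros <;> simp [add_smul]

theorem IsEPositive.sum {ι : Type*} {s : Finset ι} {f : ι → MvPowerSeries ℕ ℚ}
    (h : ∀ i ∈ s, IsEPositive (f i)) : IsEPositive (∑ i ∈ s, f i) := by
  classical
  induction s using Finset.induction_on with
  | empty => exact IsEPositive.zero
  | insert a s ha ih =>
    rw [Finset.sum_insert ha]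
    exact (h a (by simp)).add (ih fun i hi => h i (by simp [hi]))

theorem IsEPositive.smul_elemSymmPartition {n : ℕ} (p : n.Partition) {a : ℚ} (ha : 0 ≤ a) :
    IsEPositive (a • elemSymmPartition p) := by
  classical
  refine ⟨Finsupp.single ⟨n, p⟩ a, fun q => ?_, ?_⟩
  · rw [Finsupp.single_apply]
    split_ifs
    exacts [ha, le_rfl]
  · rw [Finsupp.sum_single_index (by simp)]

theorem elemSymmPartition_mul {a b : ℕ} (p : a.Partition) (q : b.Partition) :
    ∃ r : (a + b).Partition,
      elemSymmPartition r = elemSymmPartition p * elemSymmPartition q := by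
  refine ⟨⟨p.parts + q.parts, fun {i} hi => ?_, ?_⟩, ?_⟩
  · rcases Multiset.mem_add.mp hi with h | h
    exacts [p.parts_pos h, q.parts_pos h]
  · rw [Multiset.sum_add, p.parts_sum, q.parts_sum]
  · simp [elemSymmPartition]

theorem IsEPositive.mul {f g : MvPowerSeries ℕ ℚ} (hf : IsEPositive f) (hg : IsEPositive g) :
    IsEPositive (f * g) := by
  obtain ⟨c, hc, rfl⟩ := hf
  obtain ⟨c', hc', rfl⟩ := hg
  rw [Finsupp.sum, Finsupp.sum, Finset.sum_mul_sum]
  refine IsEPositive.sum fun p _ => IsEPositive.sum fun q _ => ?_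
  obtain ⟨r, hr⟩ := elemSymmPartition_mul p.2 q.2
  rw [smul_mul_smul_comm, ← hr]
  exact IsEPositive.smul_elemSymmPartition r (mul_nonneg (hc p) (hc' q))

theorem elemSymm_zero : elemSymm 0 = 1 := by
  classical
  ext d
  rw [MvPowerSeries.coeff_one]
  change (if d.degree = 0 ∧ ∀ i, d i ≤ 1 then (1 : ℚ) else 0) = _
  refine if_congr ⟨fun h => (Finsupp.degree_eq_zero_iff d).mp h.1, ?_⟩ rfl rfl
  rintro rfl
  simp

theorem IsEPositive.natCast (n : ℕ) : IsEPositive (n : MvPowerSeries ℕ ℚ) := by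
  have h := IsEPositive.smul_elemSymmPartition (Nat.Partition.indiscrete 0)
    (show (0 : ℚ) ≤ n by positivity)
  have h1 : elemSymmPartition (Nat.Partition.indiscrete 0) = 1 := by
    simp [elemSymmPartition]
  rw [h1] at h
  simpa [Nat.cast_smul_eq_nsmul] using h

theorem IsEPositive.elemSymm (n : ℕ) : IsEPositive (elemSymm n) := by
  rcases Nat.eq_zero_or_pos n with rfl | hn
  · rw [elemSymm_zero]
    simpa using IsEPositive.natCast 1
  · have h := IsEPositive.smul_elemSymmPartition (Nat.Partition.indiscrete n)
      (show (0 : ℚ) ≤ 1 by norm_num)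
    simpa [elemSymmPartition, Nat.Partition.indiscrete_parts hn.ne'] using h

variable {e d P : ℕ → MvPowerSeries ℕ ℚ}

theorem IsEPositive.weightedConv (he : ∀ n, IsEPositive (e n)) {n : ℕ} (w : ℕ → ℕ)
    (hd : ∀ k ≤ n, w k ≠ 0 → IsEPositive (d (n - k))) :
    IsEPositive (weightedConv (fun k => (w k : MvPowerSeries ℕ ℚ)) e d n) := by
  refine IsEPositive.sum fun k hk => ?_
  by_cases h : w k = 0
  · simpa [h] using IsEPositive.zero
  · exact ((IsEPositive.natCast _).mul (he k)).mul
      (hd k (Nat.lt_succ_iff.mp (Finset.mem_range.mp hk)) h)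

theorem IsEPositive.of_recurrence (he : ∀ n, IsEPositive (e n)) (h0 : IsEPositive (d 0))
    (hd : ∀ n, d (n + 1) =
      _root_.weightedConv (fun k => ((k - 1 : ℕ) : MvPowerSeries ℕ ℚ)) e d (n + 1)) (n : ℕ) :
    IsEPositive (d n) := by
  induction n using Nat.strong_induction_on with
  | _ n ih =>
    rcases n with _ | n
    · exact h0
    · rw [hd]
      -- The truncated weight vanishes at `k = 0`, so only earlier terms of `d` occur.
      exact IsEPositive.weightedConv he (fun k => k - 1) fun k _ hk => ih _ (by omega)

theorem IsEPositive.tadpoleFormula (he : ∀ n, IsEPositive (e n)) (hd : ∀ n, IsEPositive (d n))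
    (hP : ∀ n, IsEPositive (P n)) (n l : ℕ) : IsEPositive (tadpoleFormula e d P n l) :=
  (IsEPositive.weightedConv he (fun k => k * (k - (l + 1))) fun _ _ _ => hd _).add
    (IsEPositive.sum fun s _ => (hP _).mul
      (IsEPositive.weightedConv he (fun k => (s + k - l) * (k - 1)) fun _ _ _ => hd _))

end EPositive

/-! ### From power series to the coefficient recurrences. -/

section Coefficients

open PowerSeries

variable {R σ : Type*} [CommRing R] [Fintype σ] [DecidableEq σ] {x : σ → R} {e d : ℕ → R}

theorem coeff_mk_mul_mk (w : ℕ → R) (n : ℕ) :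
    coeff n (PowerSeries.mk (fun k => w k * e k) * PowerSeries.mk d) = weightedConv w e d n := by
  rw [coeff_mul, Finset.Nat.sum_antidiagonal_eq_sum_range_succ
    (fun i j => coeff i (PowerSeries.mk fun k => w k * e k) * coeff j (PowerSeries.mk d))]
  simp [weightedConv]

theorem X_mul_derivative_mk (f : ℕ → R) :
    X * d⁄dX R (PowerSeries.mk f) = PowerSeries.mk fun k => (k : R) * f k := by
  ext n
  cases n with
  | zero => simp
  | succ n =>
    rw [coeff_succ_X_mul, coeff_derivative]
    simp
    ring

theorem X_sq_mul_derivative_mk (f : ℕ → R) :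
    X ^ 2 * d⁄dX R (d⁄dX R (PowerSeries.mk f)) =
      PowerSeries.mk fun k => ((k * (k - 1) : ℕ) : R) * f k := by
  ext n
  rcases n with _ | _ | n
  · simp
  · simp [pow_two, mul_assoc, coeff_succ_X_mul]
  · rw [pow_two, mul_assoc, coeff_succ_X_mul, coeff_succ_X_mul, coeff_derivative,
      coeff_derivative]
    simp
    ring

/-- The generating function of the tadpole in finitely many variables `x`, in terms of the
elementary symmetric polynomials `e` and the coefficients `d` of `1 / (E - z E')`. -/
theorem tadpoleSum_eq_formula (hE : elemSeries x = PowerSeries.mk e)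
    (hd0 : d 0 = 1)
    (hd : ∀ n, d (n + 1) = weightedConv (fun k => ((k - 1 : ℕ) : R)) e d (n + 1)) (m l : ℕ) :
    tadpoleSum x (m + 1) l =
      tadpoleFormula e d (fun n => weightedConv (fun _ => 1) e d n) (m + 1 + l) l := by
  have he0 : e 0 = 1 := by
    have h := congrArg (coeff 0) hE
    simpa [elemSeries, map_prod] using h.symm
  have hB : elemSeries x - X * d⁄dX R (elemSeries x) =
      PowerSeries.mk fun k => (1 - (k : R)) * e k := by
    rw [hE, X_mul_derivative_mk]
    ext n
    simp
    ring
  have hD : PowerSeries.mk d * (elemSeries x - X * d⁄dX R (elemSeries x)) = 1 := by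
    rw [hB, mul_comm]
    ext n
    rw [coeff_mk_mul_mk]
    rcases n with _ | n
    · simp [weightedConv, hd0, he0]
    -- Truncation replaces `-1` by `0` at `k = 0`; the correction there contributes `e 0 * d (n + 1)
    -- = d (n + 1)`.
    · have h : (fun k : ℕ => 1 - (k : R)) =
          fun k => (if k = 0 then 1 else 0) - ((k - 1 : ℕ) : R) := by
        ext k
        rcases k with _ | k <;> simp
      rw [h, weightedConv_sub, weightedConv_single (by omega), ← hd, he0]
      simp [coeff_one]
  have hP : PowerSeries.mk (pathSum x) = elemSeries x * PowerSeries.mk d := by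
    linear_combination PowerSeries.mk d * mk_pathSum_mul x - PowerSeries.mk (pathSum x) * hD
  have hP1 : pathSum x = fun n => weightedConv (fun _ => 1) e d n := by
    ext n
    rw [← coeff_mk_mul_mk]
    have h := congrArg (coeff n) hP
    rw [hE] at h
    simpa using h
  rw [← hP1]
  refine tadpole_eq_formula hd (fun n => ?_) (fun n => ?_) (fun m => ?_) (tadpoleSum_succ x) m l
  · have h : PowerSeries.mk (pathSum x) =
        1 + (PowerSeries.mk fun k => (k : R) * e k) * PowerSeries.mk d := by
      rw [← X_mul_derivative_mk, ← hE]
      linear_combination hP + hD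
    simpa [coeff_mk_mul_mk, coeff_one] using congrArg (coeff (n + 1)) h
  · have h := congrArg (coeff (n + 1)) (mk_pathSum_mul x)
    rw [hB, hE, mul_comm, coeff_mk_mul_mk] at h
    -- Reversing the sum indexes it by the length of the remaining path; the extreme terms `k = 0`
    -- and `k = n + 1` give `P_{n+1}` and `-n e_{n+1}`.
    rw [weightedConv, ← Finset.sum_range_reflect, Finset.sum_range_succ,
      Finset.sum_range_succ'] at h
    simp only [coeff_mk] at h
    have h2 : ∀ s ∈ Finset.range n,
        (1 - ((n + 1 + 1 - 1 - (s + 1) : ℕ) : R)) * e (n + 1 + 1 - 1 - (s + 1)) *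
          pathSum x (n + 1 - (n + 1 + 1 - 1 - (s + 1))) =
        -(pathSum x (s + 1) * (((n - s - 1 : ℕ) : R) * e (n - s))) := by
      intro s hs
      rw [Finset.mem_range] at hs
      obtain ⟨j, rfl⟩ := Nat.exists_eq_add_of_lt hs
      rw [show s + j + 1 + 1 + 1 - 1 - (s + 1) = j + 1 by omega,
        show s + j + 1 + 1 - (j + 1) = s + 1 by omega,
        show s + j + 1 - s - 1 = j by omega, show s + j + 1 - s = j + 1 by omega]
      push_cast
      ring
    rw [Finset.sum_congr rfl h2, Finset.sum_neg_distrib] at h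
    simp [he0, show pathSum x 0 = 1 from rfl] at h
    push_cast
    linear_combination h
  · have h := mk_tadpoleSum_zero_eq x hD
    rw [hE, X_sq_mul_derivative_mk] at h
    have h1 := congrArg (coeff (m + 1)) h
    rw [map_add, coeff_mk_mul_mk] at h1
    -- The number of variables enters only the constant coefficient, hence the restriction to cycle
    -- length `m + 1`.
    rw [← map_natCast (C (R := R)), coeff_C] at h1
    simpa using h1

/-- The coefficients of `1 / (E - z E')`. -/
theorem exists_recurrence (e : ℕ → R) : ∃ d : ℕ → R, d 0 = 1 ∧
    ∀ n, d (n + 1) = weightedConv (fun k => ((k - 1 : ℕ) : R)) e d (n + 1) := by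
  -- This is `E - z E'` when `e 0 = 1`; truncation makes its constant coefficient `1` for any `e`.
  let B : R⟦X⟧ := 1 - PowerSeries.mk fun k => ((k - 1 : ℕ) : R) * e k
  have hB : B * invOfUnit B 1 = 1 := mul_invOfUnit B 1 (by simp [B])
  have h : invOfUnit B 1 =
      1 + (PowerSeries.mk fun k => ((k - 1 : ℕ) : R) * e k) *
        PowerSeries.mk (fun n => coeff n (invOfUnit B 1)) := by
    have h1 : PowerSeries.mk (fun n => coeff n (invOfUnit B 1)) = invOfUnit B 1 := by
      ext n; simp
    rw [h1]
    linear_combination hB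
  refine ⟨fun n => coeff n (invOfUnit B 1), by simp, fun n => ?_⟩
  have h1 := congrArg (coeff (n + 1)) h
  rw [map_add, coeff_mk_mul_mk] at h1
  simpa [coeff_one] using h1

end Coefficients

/-! ### Reduction to finitely many variables. -/

section Restriction

open scoped Classical in
/-- Setting the variables with index at least `N` to zero. -/
noncomputable def restrictVars (N : ℕ) : MvPowerSeries ℕ ℚ →+* MvPowerSeries ℕ ℚ where
  toFun f := fun d => if d.support ⊆ Finset.range N then f d else 0
  map_zero' := by
    funext d
    exact ite_self _
  map_one' := by
    ext d
    change (if d.support ⊆ Finset.range N then MvPowerSeries.coeff d (1 : MvPowerSeries ℕ ℚ)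
      else 0) = _
    rw [MvPowerSeries.coeff_one]
    by_cases h : d = 0
    · simp [h]
    · simp [h]
  map_add' f g := by
    funext d
    change (if _ then f d + g d else 0) = (if _ then f d else 0) + (if _ then g d else 0)
    split_ifs <;> simp
  map_mul' f g := by
    ext d
    refine Eq.trans ?_ (MvPowerSeries.coeff_mul d _ _).symm
    change (if d.support ⊆ Finset.range N then MvPowerSeries.coeff d (f * g) else 0) =
      ∑ p ∈ Finset.HasAntidiagonal.antidiagonal d,
      (if p.1.support ⊆ Finset.range N then MvPowerSeries.coeff p.1 f else 0) *
        (if p.2.support ⊆ Finset.range N then MvPowerSeries.coeff p.2 g else 0)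
    rw [MvPowerSeries.coeff_mul, Finset.ite_sum_zero]
    refine Finset.sum_congr rfl fun p hp => ?_
    have hs : d.support = p.1.support ∪ p.2.support := by
      rw [← Finset.HasAntidiagonal.mem_antidiagonal.mp hp]
      ext i
      simp only [Finsupp.mem_support_iff, Finsupp.add_apply, Finset.mem_union]
      omega
    simp only [hs, Finset.union_subset_iff]
    by_cases h1 : p.1.support ⊆ Finset.range N <;> by_cases h2 : p.2.support ⊆ Finset.range N <;>
      simp [h1, h2]

open scoped Classical in
theorem coeff_restrictVars (N : ℕ) (f : MvPowerSeries ℕ ℚ) (d : ℕ →₀ ℕ) :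
    MvPowerSeries.coeff d (restrictVars N f) =
      if d.support ⊆ Finset.range N then MvPowerSeries.coeff d f else 0 := rfl

/-- Each monomial involves finitely many variables, so some truncation keeps its coefficient. -/
theorem eq_of_restrictVars_eq {f g : MvPowerSeries ℕ ℚ}
    (h : ∀ N, restrictVars N f = restrictVars N g) : f = g := by
  ext d
  have h1 := congrArg (MvPowerSeries.coeff d) (h (d.support.sup id + 1))
  have hs : d.support ⊆ Finset.range (d.support.sup id + 1) := fun i hi =>
    Finset.mem_range.mpr (Nat.lt_succ_of_le (Finset.le_sup (f := id) hi))
  rwa [coeff_restrictVars, coeff_restrictVars, if_pos hs, if_pos hs] at h1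

theorem prod_X_eq_monomial {ι : Type*} (s : Finset ι) (f : ι → ℕ) :
    ∏ i ∈ s, (MvPowerSeries.X (f i) : MvPowerSeries ℕ ℚ) =
      MvPowerSeries.monomial (∑ i ∈ s, Finsupp.single (f i) 1) 1 := by
  classical
  induction s using Finset.induction_on with
  | empty => simp
  | insert a s ha ih =>
    rw [Finset.prod_insert ha, Finset.sum_insert ha, ih, MvPowerSeries.X,
      MvPowerSeries.monomial_mul_monomial, one_mul]

theorem support_colorMonomial_subset {V : Type*} [Fintype V] {N : ℕ} (κ : V → Fin N) :
    (colorMonomial fun v => (κ v : ℕ)).support ⊆ Finset.range N := by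
  classical
  refine Finsupp.support_finsetSum.trans ?_
  intro i hi
  obtain ⟨v, -, hv⟩ := Finset.mem_biUnion.mp hi
  rw [Finset.mem_singleton.mp (Finsupp.support_single_subset hv)]
  exact Finset.mem_range.mpr (κ v).isLt

theorem mem_support_colorMonomial {V : Type*} [Fintype V] (κ : V → ℕ) (v : V) :
    κ v ∈ (colorMonomial κ).support := by
  have h : (Finsupp.single (κ v) 1 : ℕ →₀ ℕ) (κ v) ≤ colorMonomial κ (κ v) := by
    rw [colorMonomial, Finsupp.finsetSum_apply]
    exact Finset.single_le_sum (f := fun w => (Finsupp.single (κ w) 1 : ℕ →₀ ℕ) (κ v))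
      (fun _ _ => Nat.zero_le _) (Finset.mem_univ v)
  rw [Finsupp.single_eq_same] at h
  rw [Finsupp.mem_support_iff]
  omega

open scoped Classical in
theorem restrictVars_chromaticSymmetricFunction {V : Type*} [Fintype V] [DecidableEq V]
    (G : SimpleGraph V) (N : ℕ) :
    restrictVars N (chromaticSymmetricFunction G) =
      ∑ κ : V → Fin N, if ∀ v w, G.Adj v w → κ v ≠ κ w then
        ∏ v, (MvPowerSeries.X (κ v : ℕ) : MvPowerSeries ℕ ℚ) else 0 := by
  ext d
  have hR : MvPowerSeries.coeff d (∑ κ : V → Fin N, if ∀ v w, G.Adj v w → κ v ≠ κ w then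
        ∏ v, (MvPowerSeries.X (κ v : ℕ) : MvPowerSeries ℕ ℚ) else 0) =
      (Nat.card {κ : V → Fin N // (∀ v w, G.Adj v w → κ v ≠ κ w) ∧
        colorMonomial (fun v => (κ v : ℕ)) = d} : ℚ) := by
    rw [map_sum, Nat.card_eq_fintype_card, Fintype.card_subtype, Finset.card_filter,
      Nat.cast_sum]
    refine Finset.sum_congr rfl fun κ _ => ?_
    rw [prod_X_eq_monomial]
    by_cases h : ∀ v w, G.Adj v w → κ v ≠ κ w
    · rw [if_pos h, MvPowerSeries.coeff_monomial]
      simp only [colorMonomial, eq_comm (a := d), Nat.cast_ite, Nat.cast_one, Nat.cast_zero]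
      refine if_congr ⟨fun h' => ⟨h, h'⟩, fun h' => h'.2⟩ rfl rfl
    · rw [if_neg h, if_neg (fun h' => h h'.1)]
      simp
  rw [hR, coeff_restrictVars]
  split_ifs with hd
  · change (Nat.card {κ : G.Coloring ℕ // colorMonomial (fun v => κ v) = d} : ℚ) = _
    congr 1
    refine Nat.card_congr ⟨fun κ => ⟨fun v => ⟨κ.1 v, ?_⟩, fun v w hvw h => ?_, κ.2⟩,
      fun κ => ⟨SimpleGraph.Coloring.mk (fun v => (κ.1 v : ℕ))
        (fun {v w} hvw h => κ.2.1 v w hvw (Fin.ext h)), κ.2.2⟩, fun κ => ?_, fun κ => ?_⟩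
    · have h := mem_support_colorMonomial (fun v => κ.1 v) v
      rw [κ.2] at h
      exact Finset.mem_range.mp (hd h)
    · exact κ.1.valid hvw (congrArg Fin.val h)
    · rfl
    · rfl
  · rw [eq_comm, Nat.cast_eq_zero, Nat.card_eq_zero]
    left
    refine ⟨fun κ => hd ?_⟩
    rw [← κ.2.2]
    exact support_colorMonomial_subset κ.1

theorem elemSeries_X (N : ℕ) :
    elemSeries (fun i : Fin N => (MvPowerSeries.X (i : ℕ) : MvPowerSeries ℕ ℚ)) =
      PowerSeries.mk fun k => restrictVars N (elemSymm k) := by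
  classical
  ext k d
  rw [PowerSeries.coeff_mk, coeff_restrictVars, elemSeries, Finset.prod_one_add, map_sum, map_sum]
  have h1 : ∀ t : Finset (Fin N), MvPowerSeries.coeff d (PowerSeries.coeff k (∏ i ∈ t,
      (PowerSeries.C (MvPowerSeries.X (i : ℕ) : MvPowerSeries ℕ ℚ)) * PowerSeries.X)) =
      if t.card = k ∧ ∑ i ∈ t, Finsupp.single (i : ℕ) 1 = d then 1 else 0 := by
    intro t
    rw [Finset.prod_mul_distrib, Finset.prod_const, ← map_prod, PowerSeries.coeff_C_mul_X_pow,
      prod_X_eq_monomial]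
    by_cases h : k = t.card
    · rw [if_pos h, MvPowerSeries.coeff_monomial]
      simp [h, eq_comm]
    · rw [if_neg h, if_neg (fun h' => h h'.1.symm)]
      simp
  have hval : ∀ (t : Finset (Fin N)) (j : ℕ), (∑ i ∈ t, Finsupp.single (i : ℕ) 1 : ℕ →₀ ℕ) j =
      if j ∈ t.map Fin.valEmbedding then 1 else 0 := by
    intro t j
    have : (∑ i ∈ t, Finsupp.single (i : ℕ) 1 : ℕ →₀ ℕ) =
        ∑ i ∈ t.map Fin.valEmbedding, Finsupp.single i 1 := by
      rw [Finset.sum_map]; rfl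
    rw [this, Finsupp.finsetSum_apply]
    simp [Finsupp.single_apply]
  rw [Finset.sum_congr rfl fun t _ => h1 t]
  change _ = if d.support ⊆ Finset.range N then
    (if d.degree = k ∧ ∀ i, d i ≤ 1 then (1 : ℚ) else 0) else 0
  rw [← ite_and]
  split_ifs with h
  · obtain ⟨hd, hk, hs⟩ := h
    -- A squarefree monomial comes from exactly one subset of the variables, its support.
    rw [Finset.sum_eq_single (Finset.univ.filter fun i : Fin N => (i : ℕ) ∈ d.support)]
    · have he : (∑ i ∈ Finset.univ.filter fun i : Fin N => (i : ℕ) ∈ d.support,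
          Finsupp.single (i : ℕ) 1) = d := by
        ext j
        rw [hval]
        have := hs j
        by_cases hj : j ∈ d.support
        · rw [if_pos]
          · rw [Finsupp.mem_support_iff] at hj
            omega
          · simp only [Finset.mem_map, Finset.mem_filter, Finset.mem_univ, true_and]
            exact ⟨⟨j, Finset.mem_range.mp (hd hj)⟩, hj, rfl⟩
        · rw [if_neg]
          · rw [Finsupp.notMem_support_iff] at hj
            exact hj.symm
          · simp only [Finset.mem_map, Finset.mem_filter, Finset.mem_univ, true_and]
            rintro ⟨i, hi, rfl⟩
            exact hj hi
      refine if_pos ⟨?_, he⟩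
      rw [← hk]
      conv_rhs => rw [← he]
      rw [map_sum]
      simp
    · intro t _ ht
      refine if_neg fun h => ht ?_
      ext i
      rw [← h.2, Finset.mem_filter, Finsupp.mem_support_iff, hval]
      simp [Fin.val_inj]
    · simp
  · refine Finset.sum_eq_zero fun t _ => if_neg fun h' => h ?_
    obtain ⟨rfl, rfl⟩ := h'
    refine ⟨?_, ?_, ?_⟩
    · intro j hj
      rw [Finsupp.mem_support_iff, hval] at hj
      simp only [ne_eq, ite_eq_right_iff, one_ne_zero, imp_false, not_not, Finset.mem_map] at hj
      obtain ⟨i, -, rfl⟩ := hj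
      exact Finset.mem_range.mpr i.isLt
    · rw [map_sum]
      simp
    · intro j
      rw [hval]
      split_ifs <;> simp

end Restriction

/-! ### Transfer operator powers as sums over words. -/

section Words

variable {R σ : Type*} [CommRing R] [Fintype σ] [DecidableEq σ] (x : σ → R)

theorem properTransfer_apply_eq_sum_ite (g : σ → R) (i : σ) :
    properTransfer x g i = ∑ j, if i ≠ j then x j * g j else 0 := by
  rw [properTransfer_apply, ← Finset.sum_filter, Finset.filter_ne, sub_eq_iff_eq_add]
  exact (Finset.sum_erase_add _ _ (Finset.mem_univ i)).symm

/-- Powers of the transfer operator sum over proper words. -/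
theorem sum_words_eq (n : ℕ) (g : σ → R) (i : σ) :
    (∑ b : Fin n → σ, if ∀ j : Fin n, (Fin.cons i b : Fin (n + 1) → σ) j.castSucc ≠ b j then
      (∏ j, x (b j)) * g ((Fin.cons i b : Fin (n + 1) → σ) (Fin.last n)) else 0) =
      (properTransfer x ^ n) g i := by
  induction n generalizing i with
  | zero => simp
  | succ n ih =>
    rw [pow_succ', Module.End.mul_apply, properTransfer_apply_eq_sum_ite,
      ← (Fin.consEquiv fun _ => σ).sum_comp, Fintype.sum_prod_type]
    refine Finset.sum_congr rfl fun a _ => ?_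
    rw [← ih, Finset.mul_sum, Finset.ite_sum_zero]
    refine Finset.sum_congr rfl fun b _ => ?_
    simp only [Fin.consEquiv_apply, Fin.forall_fin_succ, Fin.castSucc_zero, Fin.cons_zero,
      Fin.cons_succ, ← Fin.succ_castSucc, ← Fin.succ_last, Fin.prod_univ_succ, ite_and, mul_ite,
      mul_zero, mul_assoc]

end Words

/-! ### Proper colorings of the tadpole as pairs of words. -/

section Tadpole

theorem cycleGraph_proper_iff {σ : Type*} (r : ℕ) (a : Fin (r + 2) → σ) :
    (∀ u v, (SimpleGraph.cycleGraph (r + 2)).Adj u v → a u ≠ a v) ↔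
      (∀ j : Fin (r + 1), a j.castSucc ≠ a j.succ) ∧ a (Fin.last (r + 1)) ≠ a 0 := by
  have key : (∀ u v, (SimpleGraph.cycleGraph (r + 2)).Adj u v → a u ≠ a v) ↔
      ∀ v, a v ≠ a (v + 1) := by
    constructor
    · intro h v
      exact h _ _ (SimpleGraph.cycleGraph_adj.mpr (Or.inr (by abel)))
    · intro h u v huv
      rcases SimpleGraph.cycleGraph_adj.mp huv with h1 | h1
      · rw [sub_eq_iff_eq_add.mp h1, add_comm]
        exact (h v).symm
      · rw [sub_eq_iff_eq_add.mp h1, add_comm]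
        exact h u
  rw [key]
  constructor
  · intro h
    refine ⟨fun j => ?_, ?_⟩
    · have := h j.castSucc
      rwa [Fin.coeSucc_eq_succ] at this
    · have := h (Fin.last (r + 1))
      rwa [Fin.last_add_one] at this
  · rintro ⟨h1, h2⟩ v
    induction v using Fin.lastCases with
    | last => rwa [Fin.last_add_one]
    | cast j => rw [Fin.coeSucc_eq_succ]; exact h1 j

theorem pathGraph_proper_iff {σ : Type*} (l : ℕ) (i : σ) (c : Fin l → σ) :
    ((∀ u v, (SimpleGraph.pathGraph l).Adj u v → c u ≠ c v) ∧ ∀ j : Fin l, j.val = 0 → i ≠ c j) ↔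
      ∀ j : Fin l, (Fin.cons i c : Fin (l + 1) → σ) j.castSucc ≠ c j := by
  rcases l with _ | l
  · simp
  · rw [Fin.forall_fin_succ (P := fun j : Fin (l + 1) =>
      (Fin.cons i c : Fin (l + 2) → σ) j.castSucc ≠ c j)]
    simp only [Fin.castSucc_zero, Fin.cons_zero, ← Fin.succ_castSucc, Fin.cons_succ]
    constructor
    · rintro ⟨h1, h2⟩
      exact ⟨h2 0 rfl, fun j => h1 _ _ (SimpleGraph.pathGraph_adj.mpr (Or.inl (by simp)))⟩
    · rintro ⟨h1, h2⟩
      have h3 : ∀ u v : Fin (l + 1), u.val + 1 = v.val → c u ≠ c v := by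
        intro u v huv
        have hu : u.val < l := by omega
        have e1 : u = (⟨u.val, hu⟩ : Fin l).castSucc := rfl
        have e2 : v = (⟨u.val, hu⟩ : Fin l).succ := Fin.ext huv.symm
        rw [e1, e2]
        exact h2 _
      refine ⟨fun u v huv => ?_, fun j hj => ?_⟩
      · rcases SimpleGraph.pathGraph_adj.mp huv with h | h
        · exact h3 _ _ h
        · exact (h3 _ _ h).symm
      · rwa [show j = 0 from Fin.ext hj]

theorem tadpole_proper_iff {σ : Type*} (r l : ℕ) (a : Fin (r + 2) → σ) (c : Fin l → σ) :
    (∀ v w, (tadpole (r + 2) l).Adj v w → (Sum.elim a c v : σ) ≠ Sum.elim a c w) ↔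
      ((∀ j : Fin (r + 1), a j.castSucc ≠ a j.succ) ∧ a (Fin.last (r + 1)) ≠ a 0) ∧
        ∀ j : Fin l, (Fin.cons (a 0) c : Fin (l + 1) → σ) j.castSucc ≠ c j := by
  rw [← cycleGraph_proper_iff, ← pathGraph_proper_iff]
  constructor
  · intro h
    refine ⟨fun u v huv => h (Sum.inl u) (Sum.inl v) (Or.inl huv),
      fun u v huv => h (Sum.inr u) (Sum.inr v) (Or.inl huv),
      fun j hj => h (Sum.inl 0) (Sum.inr j) (Or.inr ⟨by simp, Or.inl ⟨0, j, rfl, hj, rfl, rfl⟩⟩)⟩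
  · rintro ⟨h1, h2, h3⟩ v w (hvw | ⟨-, ⟨i, j, hi, hj, rfl, rfl⟩ | ⟨i, j, hi, hj, rfl, rfl⟩⟩)
    · rcases v with v | v <;> rcases w with w | w
      · exact h1 v w hvw
      · simp at hvw
      · simp at hvw
      · exact h2 v w hvw
    · rw [show i = 0 from Fin.ext hi]
      exact h3 j hj
    · rw [show i = 0 from Fin.ext hi]
      exact (h3 j hj).symm

open scoped Classical in
theorem sum_tadpole_colorings {R σ : Type*} [CommRing R] [Fintype σ] [DecidableEq σ]
    (x : σ → R) (r l : ℕ) :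
    (∑ κ : Fin (r + 2) ⊕ Fin l → σ,
      if ∀ v w, (tadpole (r + 2) l).Adj v w → κ v ≠ κ w then ∏ v, x (κ v) else 0) =
      tadpoleSum x (r + 2) l := by
  rw [← (Equiv.sumArrowEquivProdArrow (Fin (r + 2)) (Fin l) σ).symm.sum_comp,
    Fintype.sum_prod_type, ← (Fin.consEquiv fun _ => σ).sum_comp, Fintype.sum_prod_type,
    tadpoleSum]
  refine Finset.sum_congr rfl fun i _ => ?_
  -- The first application of the operator to `Pi.single i 1` is the return to `i`. It forces the
  -- last of the `r + 1` remaining cycle letters to differ from `i` and supplies the weight `x i` of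
  -- the junction, which the tail sum omits.
  have hc : closedSum x (r + 2) i =
      (properTransfer x ^ (r + 1)) (fun j => if j ≠ i then x i else 0) i := by
    have hg : x i • (1 - Pi.single i 1 : σ → R) = fun j => if j ≠ i then x i else 0 := by
      ext j
      by_cases h : j = i <;> simp [h]
    rw [closedSum, pow_succ, Module.End.mul_apply, properTransfer_single, hg]
  rw [hc, tailSum, ← sum_words_eq, ← sum_words_eq, mul_comm, Finset.sum_mul_sum]
  refine Finset.sum_congr rfl fun b _ => Finset.sum_congr rfl fun c _ => ?_
  have he : (Equiv.sumArrowEquivProdArrow (Fin (r + 2)) (Fin l) σ).symm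
      ((Fin.consEquiv fun _ => σ) (i, b), c) = Sum.elim (Fin.cons i b : Fin (r + 2) → σ) c := rfl
  rw [he]
  simp only [tadpole_proper_iff, Fin.cons_zero, Fin.cons_succ, Fintype.prod_sum_type,
    Sum.elim_inl, Sum.elim_inr, Fin.prod_univ_succ (n := r + 1), Pi.one_apply, mul_one]
  by_cases h1 : ∀ j : Fin (r + 1), (Fin.cons i b : Fin (r + 2) → σ) j.castSucc ≠ b j
  · by_cases h2 : (Fin.cons i b : Fin (r + 2) → σ) (Fin.last (r + 1)) ≠ i
    · by_cases h3 : ∀ j : Fin l, (Fin.cons i c : Fin (l + 1) → σ) j.castSucc ≠ c j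
      · rw [if_pos ⟨⟨h1, h2⟩, h3⟩, if_pos h1, if_pos h2, if_pos h3]
        ring
      · rw [if_neg (fun h => h3 h.2), if_neg h3, mul_zero]
    · rw [if_neg (fun h => h2 h.1.2), if_neg h2, mul_zero, ite_self, zero_mul]
  · rw [if_neg (fun h => h1 h.1.1), if_neg h1, zero_mul]

end Tadpole

theorem mainTheorem5 (m l : ℕ) (hm : 3 ≤ m) (hl : 1 ≤ l) :
    (tadpole m l).IsEPositive := by
  obtain ⟨r, rfl⟩ := Nat.exists_eq_add_of_le' (show 2 ≤ m by omega)
  obtain ⟨d, hd0, hd⟩ := exists_recurrence elemSymm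
  have hdpos : ∀ n, IsEPositive (d n) := IsEPositive.of_recurrence IsEPositive.elemSymm
    (by rw [hd0]; simpa using IsEPositive.natCast 1) hd
  have hPpos : ∀ n, IsEPositive (weightedConv (fun _ => 1) elemSymm d n) := fun n => by
    simpa using IsEPositive.weightedConv IsEPositive.elemSymm (fun _ => 1) (n := n)
      fun _ _ _ => hdpos _
  have h : chromaticSymmetricFunction (tadpole (r + 2) l) = tadpoleFormula elemSymm d
      (fun n => weightedConv (fun _ => 1) elemSymm d n) (r + 2 + l) l := by
    -- Setting variables to zero is a ring homomorphism, so it commutes with the formula and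
    -- preserves the recurrence defining `d`.
    refine eq_of_restrictVars_eq fun N => ?_
    rw [restrictVars_chromaticSymmetricFunction]
    refine Eq.trans ?_ ((sum_tadpole_colorings
      (fun i : Fin N => (MvPowerSeries.X (i : ℕ) : MvPowerSeries ℕ ℚ)) r l).trans ?_)
    · exact Finset.sum_congr rfl fun κ _ => by congr
    have hdN : ∀ n, restrictVars N (d (n + 1)) = weightedConv
        (fun k => ((k - 1 : ℕ) : MvPowerSeries ℕ ℚ)) (fun k => restrictVars N (elemSymm k))
        (fun k => restrictVars N (d k)) (n + 1) := fun n => by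
      simp only [hd n, map_weightedConv, map_natCast]
    have key := tadpoleSum_eq_formula (d := fun k => restrictVars N (d k)) (elemSeries_X N)
      (by simp only [hd0, map_one]) hdN (r + 1) l
    rw [show r + 1 + 1 = r + 2 from rfl] at key
    rw [key, map_tadpoleFormula]
    simp only [map_weightedConv, map_one]
  rw [SimpleGraph.IsEPositive, h]
  exact IsEPositive.tadpoleFormula IsEPositive.elemSymm hdpos hPpos _ _
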